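/- Let $m$ be a natural number, let $\mathbb{R}^m$ carry the Euclidean norm $|\cdot|$. A function $f$ is said to be of class $\mathcal C^{1,1}$ on an open set $V\subset\mathbb{R}^m$ if it is continuously differentiable on $V$ and $\nabla f$ is locally Lipschitz on $V$, i.e. every point of $V$ has a neighborhood in $V$ on which $\nabla f$ is Lipschitz. (1) Let $\Omega\subset\mathbb{R}^m$ be an open set and let $\varphi:\Omega\to\mathbb{R}$ be differentiable at every point of $\Omega$, with $|\nabla\varphi(x)|=1$ for all $x\in\Omega$. Then $\varphi\in\mathcal C^{1,1}(\Omega)$. (2) Let $D\subsetneq\mathbb{R}^m$ be a nonempty proper open subset, and let $d_D$ be the signed distance function to $\partial D$, that is, $d_D(x)=\min_{y\in\partial D}|x-y|$ for $x\in D$ and $d_D(x)=-\min_{y\in\partial D}|x-y|$ for $x\in\mathbb{R}^m\setminus D$. Let $U$ be an open set containing $\partial D$. If $d_D$ is differentiable at every point of $U$ and $|\nabla d_D(x)|=1$ for all $x\in U\cap\partial D$, then $d_D\in\mathcal C^{1,1}(U)$. -/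

import Mathlib

/-- `IsC11On f s` (for an open set `s` of a Euclidean space): `f` is of class `C^{1,1}` on `s`,
that is, `f` is continuously differentiable on `s` and its gradient is locally Lipschitz on `s`
(every point of `s` has a neighbourhood in `s` on which the gradient is Lipschitz). -/
def IsC11On {m : ℕ} (f : EuclideanSpace ℝ (Fin m) → ℝ) (s : Set (EuclideanSpace ℝ (Fin m))) :
    Prop :=
  ContDiffOn ℝ 1 f s ∧ LocallyLipschitzOn s (fun x => gradient f x)

open Classical in
/-- The signed distance function to the boundary of `D`: the Euclidean distance to `∂D` at the
points of `D`, and minus that distance at the points outside `D`. (When `∂D` is nonempty, the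
infimum in `Metric.infDist` is a minimum, since `∂D` is closed.) -/
noncomputable def signedBoundaryDist {m : ℕ} (D : Set (EuclideanSpace ℝ (Fin m)))
    (x : EuclideanSpace ℝ (Fin m)) : ℝ :=
  if x ∈ D then Metric.infDist x (frontier D) else -Metric.infDist x (frontier D)

open Metric Set Filter Topology
open scoped RealInnerProductSpace

/-! Around each point `x`, a function `φ` with unit gradient is 1-Lipschitz on balls and attains
both `φ x + t` and `φ x - t` on small spheres of radius `t` (`exists_mem_sphere_add_le` for `φ` and
`-φ`). The cones based at these extremal points touch `φ` at `x` from below and above, and their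
curvature at `x` is of order `1 / t`. Hence `φ` has a two-sided quadratic Taylor bound with uniform
constant, which forces a locally Lipschitz gradient. For the signed distance,
`norm_gradient_infDist_eq_one` gives the unit gradient off the boundary, so the first part applies
on all of `U`. -/

section Eikonal

variable {E : Type*} [NormedAddCommGroup E] [InnerProductSpace ℝ E]

/-- At a point where `φ` has a unit gradient `g`, the function grows along `g` at any rate below
one. -/
lemma HasGradientAt.eventually_add_mul_lt [CompleteSpace E] {φ : E → ℝ} {g y : E} {c : ℝ}
    (hφ : HasGradientAt φ g y) (hg : ‖g‖ = 1) (hc : c < 1) :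
    ∀ᶠ s in 𝓝[>] (0 : ℝ), φ y + c * s < φ (y + s • g) := by
  have hline : HasDerivAt (fun s : ℝ => y + s • g) g 0 := by
    simpa using ((hasDerivAt_id (0 : ℝ)).smul_const g).const_add y
  have hφ' : HasFDerivAt φ (InnerProductSpace.toDual ℝ E g) (y + (0 : ℝ) • g) := by
    simpa using hφ.hasFDerivAt
  have hder : HasDerivAt (fun s : ℝ => φ (y + s • g)) 1 0 := by
    have := hφ'.comp_hasDerivAt (0 : ℝ) hline
    simpa [Function.comp_def, hg] using this
  have hslope := (hasDerivAt_iff_tendsto_slope_zero.1 hder).eventually (lt_mem_nhds hc)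
  have hslope' : ∀ᶠ s in 𝓝[>] (0 : ℝ), _ :=
    hslope.filter_mono (nhdsWithin_mono _ fun s (hs : 0 < s) => hs.ne')
  filter_upwards [hslope', self_mem_nhdsWithin] with s hs (hs0 : 0 < s)
  simp only [zero_add, zero_smul, add_zero, smul_eq_mul] at hs
  rw [inv_mul_eq_div, lt_div_iff₀ hs0] at hs
  linarith

/-- A function with unit gradient on a closed ball attains the largest increment allowed by its
Lipschitz constant on the sphere. -/
lemma exists_mem_sphere_add_le [ProperSpace E] {φ : E → ℝ} {x : E} {t : ℝ} (ht : 0 < t)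
    (hd : ∀ y ∈ closedBall x t, DifferentiableAt ℝ φ y)
    (hg : ∀ y ∈ closedBall x t, ‖gradient φ y‖ = 1) :
    ∃ y ∈ sphere x t, φ x + t ≤ φ y := by
  have hcont : ContinuousOn φ (closedBall x t) := fun y hy =>
    (hd y hy).continuousAt.continuousWithinAt
  -- Maximize `φ - c‖· - x‖`: at an interior point, a step `s` along the gradient gains more than `c
  -- * s` and costs at most `c * s`, so the maximum lies on the sphere. Compactness of the sphere
  -- then lets `c` tend to 1.
  have key : ∀ c : ℝ, 0 ≤ c → c < 1 → ∃ y ∈ sphere x t, φ x + c * t ≤ φ y := by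
    intro c hc0 hc1
    obtain ⟨y, hy, hmax⟩ := (isCompact_closedBall x t).exists_isMaxOn
      ⟨x, mem_closedBall_self ht.le⟩
      (hcont.sub (Continuous.continuousOn (f := fun y => c * ‖y - x‖) (by fun_prop)))
    have hyt : ‖y - x‖ ≤ t := by simpa [dist_eq_norm] using hy
    have hsph : ‖y - x‖ = t := by
      by_contra hne
      have hlt : ‖y - x‖ < t := lt_of_le_of_ne hyt hne
      have hsmall : ∀ᶠ s in 𝓝[>] (0 : ℝ), s < t - ‖y - x‖ :=
        nhdsWithin_le_nhds (gt_mem_nhds (sub_pos.2 hlt))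
      obtain ⟨s, hs1, hs2, hs0⟩ := (((hd y hy).hasGradientAt.eventually_add_mul_lt (hg y hy)
        hc1).and (hsmall.and self_mem_nhdsWithin)).exists
      have hs0 : 0 < s := hs0
      have hnorm : ‖y + s • gradient φ y - x‖ ≤ ‖y - x‖ + s := by
        calc ‖y + s • gradient φ y - x‖ = ‖(y - x) + s • gradient φ y‖ := by congr 1; abel
          _ ≤ ‖y - x‖ + ‖s • gradient φ y‖ := norm_add_le _ _
          _ = ‖y - x‖ + s := by rw [norm_smul, hg y hy, mul_one, Real.norm_of_nonneg hs0.le]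
      have hmem : y + s • gradient φ y ∈ closedBall x t := by
        rw [mem_closedBall, dist_eq_norm]; linarith
      have hle : φ (y + s • gradient φ y) - c * ‖y + s • gradient φ y - x‖ ≤ φ y - c * ‖y - x‖ :=
        hmax hmem
      nlinarith [mul_le_mul_of_nonneg_left hnorm hc0]
    refine ⟨y, by simpa [dist_eq_norm] using hsph, ?_⟩
    have hle : φ x - c * ‖x - x‖ ≤ φ y - c * ‖y - x‖ := hmax (mem_closedBall_self ht.le)
    rw [sub_self, norm_zero, hsph] at hle
    linarith
  -- Used only to know that the sphere is nonempty.
  obtain ⟨y₀, hy₀, -⟩ := key 0 le_rfl one_pos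
  obtain ⟨y, hy, hmax⟩ := (isCompact_sphere x t).exists_isMaxOn ⟨y₀, hy₀⟩
    (hcont.mono sphere_subset_closedBall)
  refine ⟨y, hy, le_of_forall_pos_le_add fun ε hε => ?_⟩
  obtain ⟨z, hz, hle⟩ := key (max 0 (1 - ε / t)) (le_max_left _ _)
    (max_lt one_pos (by have := div_pos hε ht; linarith))
  have h1 : φ z ≤ φ y := hmax hz
  have h2 : (1 - ε / t) * t ≤ max 0 (1 - ε / t) * t :=
    mul_le_mul_of_nonneg_right (le_max_right _ _) ht.le
  have h3 : (1 - ε / t) * t = t - ε := by field_simp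
  linarith

lemma gradient_fun_neg [CompleteSpace E] (φ : E → ℝ) (x : E) :
    gradient (fun y => -φ y) x = -gradient φ x := by
  simp [gradient, fderiv_fun_neg]

lemma lipschitzOnWith_one_of_norm_gradient_eq_one [CompleteSpace E] {φ : E → ℝ} {s : Set E}
    (hs : Convex ℝ s) (hd : ∀ y ∈ s, DifferentiableAt ℝ φ y)
    (hg : ∀ y ∈ s, ‖gradient φ y‖ = 1) : LipschitzOnWith 1 φ s := by
  refine hs.lipschitzOnWith_of_nnnorm_fderiv_le hd fun y hy => ?_
  rw [← NNReal.coe_le_coe, coe_nnnorm, NNReal.coe_one, ← hg y hy, gradient,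
    LinearIsometryEquiv.norm_map]

/-- Expand `‖v + h‖ ^ 2` in `2t‖v + h‖ ≤ ‖v + h‖ ^ 2 + t ^ 2`. -/
lemma norm_add_le_of_norm_eq {v h : E} {t : ℝ} (ht : 0 < t) (hv : ‖v‖ = t) :
    ‖v + h‖ ≤ t + ⟪t⁻¹ • v, h⟫ + (2 * t)⁻¹ * ‖h‖ ^ 2 := by
  have hsq := norm_add_sq_real v h
  rw [hv] at hsq
  have h1 : 2 * t * ‖v + h‖ ≤ ‖v + h‖ ^ 2 + t ^ 2 := by nlinarith [sq_nonneg (‖v + h‖ - t)]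
  have h2 : 2 * t * (t + ⟪t⁻¹ • v, h⟫ + (2 * t)⁻¹ * ‖h‖ ^ 2) =
      2 * t ^ 2 + 2 * ⟪v, h⟫ + ‖h‖ ^ 2 := by
    rw [real_inner_smul_left]; field_simp
  refine le_of_mul_le_mul_left ?_ (by positivity : 0 < 2 * t)
  linarith

/-- A quadratic upper bound touching `φ` at a point of differentiability is tangent to it. -/
lemma gradient_eq_of_eventually_le [CompleteSpace E] {φ : E → ℝ} {x p : E} {C : ℝ}
    (hd : DifferentiableAt ℝ φ x)
    (h : ∀ᶠ w in 𝓝 x, φ w ≤ φ x + ⟪p, w - x⟫ + C * ‖w - x‖ ^ 2) : gradient φ x = p := by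
  have hmax : IsLocalMax (fun w => φ w - ⟪p, w - x⟫ - C * ‖w - x‖ ^ 2) x := by
    filter_upwards [h] with w hw
    simp only [sub_self, inner_zero_right, norm_zero]
    linarith
  have h1 : HasFDerivAt (fun w => ⟪p, w - x⟫) (innerSL ℝ p) x :=
    (innerSL ℝ p).hasFDerivAt.comp x ((hasFDerivAt_id x).sub_const x)
  have h2 : HasFDerivAt (fun w => C * ‖w - x‖ ^ 2) (0 : E →L[ℝ] ℝ) x := by
    simpa using (((hasFDerivAt_id x).sub_const x).norm_sq).const_mul C
  have h0 := hmax.hasFDerivAt_eq_zero ((hd.hasFDerivAt.sub h1).sub h2)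
  rw [sub_zero, sub_eq_zero] at h0
  rw [gradient, h0]
  exact (InnerProductSpace.toDual ℝ E).symm_apply_apply p

/-- Choose `z` at distance `t` from `x` with `φ z ≤ φ x - t`. The Lipschitz bound `φ w ≤ φ z + ‖w -
z‖` is a cone touching `φ` at `x`; its quadratic majorant has slope `t⁻¹ • (x - z)`, which tangency
identifies with the gradient. -/
lemma le_add_inner_gradient_of_norm_gradient_eq_one [ProperSpace E] {φ : E → ℝ} {x₀ x w : E}
    {t : ℝ} (hd : ∀ y ∈ ball x₀ (3 * t), DifferentiableAt ℝ φ y)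
    (hg : ∀ y ∈ ball x₀ (3 * t), ‖gradient φ y‖ = 1)
    (hx : x ∈ ball x₀ t) (hw : w ∈ ball x₀ (3 * t)) :
    φ w ≤ φ x + ⟪gradient φ x, w - x⟫ + (2 * t)⁻¹ * ‖w - x‖ ^ 2 := by
  have ht : 0 < t := dist_nonneg.trans_lt hx
  have hsub : closedBall x t ⊆ ball x₀ (3 * t) := fun y hy => by
    have := dist_triangle y x x₀
    rw [mem_closedBall] at hy
    rw [mem_ball] at hx ⊢
    linarith
  have hx' := hsub (mem_closedBall_self ht.le)
  obtain ⟨z, hz, hle⟩ := exists_mem_sphere_add_le (φ := fun y => -φ y) ht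
    (fun y hy => (hd y (hsub hy)).neg)
    (fun y hy => by rw [gradient_fun_neg, norm_neg, hg y (hsub hy)])
  have hv : ‖x - z‖ = t := by rw [norm_sub_rev]; simpa [dist_eq_norm] using hz
  have hlip := lipschitzOnWith_one_of_norm_gradient_eq_one (convex_ball x₀ (3 * t)) hd hg
  have bound : ∀ u ∈ ball x₀ (3 * t),
      φ u ≤ φ x + ⟪t⁻¹ • (x - z), u - x⟫ + (2 * t)⁻¹ * ‖u - x‖ ^ 2 := by
    intro u hu
    have h1 := hlip.dist_le_mul u hu z (hsub (sphere_subset_closedBall hz))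
    have h2 := norm_add_le_of_norm_eq (h := u - x) ht hv
    have h3 : x - z + (u - x) = u - z := by abel
    rw [h3] at h2
    rw [NNReal.coe_one, one_mul, Real.dist_eq, dist_eq_norm] at h1
    linarith [le_abs_self (φ u - φ z)]
  have hgrad := gradient_eq_of_eventually_le (hd x hx')
    (eventually_of_mem (isOpen_ball.mem_nhds hx') bound)
  rw [hgrad]
  exact bound w hw

lemma abs_sub_inner_gradient_le_of_norm_gradient_eq_one [ProperSpace E] {φ : E → ℝ} {x₀ x w : E}
    {t : ℝ} (hd : ∀ y ∈ ball x₀ (3 * t), DifferentiableAt ℝ φ y)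
    (hg : ∀ y ∈ ball x₀ (3 * t), ‖gradient φ y‖ = 1)
    (hx : x ∈ ball x₀ t) (hw : w ∈ ball x₀ (3 * t)) :
    |φ w - φ x - ⟪gradient φ x, w - x⟫| ≤ (2 * t)⁻¹ * ‖w - x‖ ^ 2 := by
  have h1 := le_add_inner_gradient_of_norm_gradient_eq_one hd hg hx hw
  have h2 := le_add_inner_gradient_of_norm_gradient_eq_one (φ := fun y => -φ y)
    (fun y hy => (hd y hy).neg) (fun y hy => by rw [gradient_fun_neg, norm_neg, hg y hy]) hx hw
  rw [gradient_fun_neg, inner_neg_left] at h2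
  rw [abs_le]
  constructor <;> linarith

lemma norm_gradient_sub_le_of_norm_gradient_eq_one [ProperSpace E] {φ : E → ℝ} {x₀ x y : E}
    {t : ℝ} (hd : ∀ y ∈ ball x₀ (3 * t), DifferentiableAt ℝ φ y)
    (hg : ∀ y ∈ ball x₀ (3 * t), ‖gradient φ y‖ = 1)
    (hx : x ∈ ball x₀ (t / 2)) (hy : y ∈ ball x₀ (t / 2)) :
    ‖gradient φ y - gradient φ x‖ ≤ 3 / t * ‖y - x‖ := by
  rw [mem_ball] at hx hy
  have ht : 0 < t := by linarith [dist_nonneg.trans_lt hx]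
  rcases eq_or_ne (gradient φ y - gradient φ x) 0 with h0 | h0
  · rw [h0, norm_zero]; positivity
  set v := gradient φ y - gradient φ x with hv
  have hv0 : 0 < ‖v‖ := norm_pos_iff.2 h0
  rcases eq_or_ne x y with rfl | hne
  · simp at hv; exact absurd hv h0
  set δ := ‖y - x‖ with hδ
  have hδ0 : 0 < δ := norm_pos_iff.2 (sub_ne_zero.2 hne.symm)
  have hδt : δ < t := by
    have := dist_triangle_right y x x₀
    rw [dist_eq_norm y x] at this
    linarith
  -- Comparing the expansions from `x` and from `y` at `y + k` isolates `⟪v, k⟫ = δ * ‖v‖`. The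
  -- errors are `δ ^ 2`, `(2 * δ) ^ 2` and `δ ^ 2` over `2 * t`, whence the constant `3 / t`.
  set k := (δ / ‖v‖) • v with hk
  have hknorm : ‖k‖ = δ := by
    rw [hk, norm_smul, Real.norm_of_nonneg (by positivity)]; field_simp
  have hyk : y + k ∈ ball x₀ (3 * t) := by
    have := dist_triangle (y + k) y x₀
    rw [dist_eq_norm (y + k) y, add_sub_cancel_left, hknorm] at this
    rw [mem_ball]
    linarith
  have hx1 : x ∈ ball x₀ t := by rw [mem_ball]; linarith
  have hy1 : y ∈ ball x₀ t := by rw [mem_ball]; linarith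
  have hy3 : y ∈ ball x₀ (3 * t) := by rw [mem_ball]; linarith
  have e1 := (abs_le.1 (abs_sub_inner_gradient_le_of_norm_gradient_eq_one hd hg hy1 hyk)).1
  have e2 := (abs_le.1 (abs_sub_inner_gradient_le_of_norm_gradient_eq_one hd hg hx1 hyk)).2
  have e3 := (abs_le.1 (abs_sub_inner_gradient_le_of_norm_gradient_eq_one hd hg hx1 hy3)).1
  rw [add_sub_cancel_left, hknorm] at e1
  have hsplit : y + k - x = (y - x) + k := by abel
  have hn : ‖(y - x) + k‖ ≤ 2 * δ := (norm_add_le _ _).trans (by rw [hknorm]; linarith)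
  rw [hsplit, inner_add_right] at e2
  have hn2 : ‖(y - x) + k‖ ^ 2 ≤ (2 * δ) ^ 2 := pow_le_pow_left₀ (norm_nonneg _) hn 2
  have hn3 := mul_le_mul_of_nonneg_left hn2 (by positivity : 0 ≤ (2 * t)⁻¹)
  have hinner : ⟪gradient φ y, k⟫ - ⟪gradient φ x, k⟫ = δ * ‖v‖ := by
    rw [← inner_sub_left, ← hv, hk, real_inner_smul_right, real_inner_self_eq_norm_sq]
    field_simp
  have hfin : δ * ‖v‖ ≤ δ * (3 / t * δ) := by
    have : δ * (3 / t * δ) = 6 * ((2 * t)⁻¹ * δ ^ 2) := by field_simp; norm_num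
    rw [this, ← hinner]
    linarith
  exact le_of_mul_le_mul_left hfin hδ0

lemma locallyLipschitzOn_gradient_of_norm_gradient_eq_one [ProperSpace E] {φ : E → ℝ}
    {Ω : Set E} (hΩ : IsOpen Ω) (hd : ∀ x ∈ Ω, DifferentiableAt ℝ φ x)
    (hg : ∀ x ∈ Ω, ‖gradient φ x‖ = 1) : LocallyLipschitzOn Ω (gradient φ) := by
  intro x₀ hx₀
  obtain ⟨r, hr, hball⟩ := Metric.isOpen_iff.1 hΩ x₀ hx₀
  have hsub : ball x₀ (3 * (r / 3)) ⊆ Ω := by rwa [mul_div_cancel₀ r three_ne_zero]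
  refine ⟨Real.toNNReal (3 / (r / 3)), ball x₀ (r / 3 / 2),
    mem_nhdsWithin_of_mem_nhds (ball_mem_nhds _ (by positivity)), ?_⟩
  refine LipschitzOnWith.of_dist_le_mul fun y hy x hx => ?_
  rw [Real.coe_toNNReal _ (by positivity), dist_eq_norm, dist_eq_norm]
  exact norm_gradient_sub_le_of_norm_gradient_eq_one (fun z hz => hd z (hsub hz))
    (fun z hz => hg z (hsub hz)) hx hy

lemma contDiffOn_one_of_continuousOn_gradient [CompleteSpace E] {φ : E → ℝ} {Ω : Set E}
    (hΩ : IsOpen Ω) (hd : ∀ x ∈ Ω, DifferentiableAt ℝ φ x)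
    (hg : ContinuousOn (gradient φ) Ω) : ContDiffOn ℝ 1 φ Ω := by
  rw [← zero_add 1]
  refine (contDiffOn_succ_iff_fderiv_of_isOpen hΩ).2
    ⟨fun x hx => (hd x hx).differentiableWithinAt, by simp, contDiffOn_zero.2 ?_⟩
  refine ((InnerProductSpace.toDual ℝ E).continuous.comp_continuousOn hg).congr fun x _ => ?_
  exact ((InnerProductSpace.toDual ℝ E).apply_symm_apply _).symm

/-- The distance is 1-Lipschitz, and it decreases at unit rate towards a nearest point. -/
lemma norm_gradient_infDist_eq_one [ProperSpace E] {s : Set E} {x : E} (hs : IsClosed s)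
    (hne : s.Nonempty) (hx : x ∉ s) (hd : DifferentiableAt ℝ (fun y => infDist y s) x) :
    ‖gradient (fun y => infDist y s) x‖ = 1 := by
  obtain ⟨y, hy, hxy⟩ := hs.exists_infDist_eq_dist hne x
  have hpos : 0 < dist x y := dist_pos.2 fun h => hx (h ▸ hy)
  have hgnorm : ‖gradient (fun y => infDist y s) x‖ = ‖fderiv ℝ (fun y => infDist y s) x‖ := by
    rw [gradient, LinearIsometryEquiv.norm_map]
  rw [hgnorm]
  refine le_antisymm (by simpa using
    norm_fderiv_le_of_lipschitz ℝ (x₀ := x) (lipschitz_infDist_pt s)) ?_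
  have hline : HasDerivAt (fun r : ℝ => x + r • (y - x)) (y - x) 0 := by
    simpa using ((hasDerivAt_id (0 : ℝ)).smul_const (y - x)).const_add x
  have hder : HasDerivAt (fun r : ℝ => infDist (x + r • (y - x)) s)
      (fderiv ℝ (fun y => infDist y s) x (y - x)) 0 := by
    have hd' : HasFDerivAt (fun y => infDist y s) (fderiv ℝ (fun y => infDist y s) x)
        (x + (0 : ℝ) • (y - x)) := by simpa using hd.hasFDerivAt
    exact hd'.comp_hasDerivAt (0 : ℝ) hline
  -- The distance decreases at least at unit speed towards a nearest point.
  have hle : ∀ r ∈ Icc (0 : ℝ) 1, infDist (x + r • (y - x)) s ≤ (1 - r) * dist x y := by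
    intro r hr
    refine (infDist_le_dist_of_mem hy).trans ?_
    have : x + r • (y - x) - y = (1 - r) • (x - y) := by module
    rw [dist_eq_norm, this, norm_smul, Real.norm_of_nonneg (by linarith [hr.2]), dist_eq_norm]
  have hslope := (hasDerivAt_iff_tendsto_slope_zero.1 hder).mono_left
    (nhdsWithin_mono (0 : ℝ) fun r (hr : r ∈ Ioi 0) => (mem_Ioi.1 hr).ne')
  have hbound : fderiv ℝ (fun y => infDist y s) x (y - x) ≤ -dist x y := by
    refine le_of_tendsto hslope ?_
    filter_upwards [Ioc_mem_nhdsGT (zero_lt_one' ℝ)] with r hr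
    have := hle r ⟨hr.1.le, hr.2⟩
    simp only [zero_add, zero_smul, add_zero, smul_eq_mul, hxy]
    rw [inv_mul_eq_div, div_le_iff₀ hr.1]
    linarith
  have hop := (fderiv ℝ (fun y => infDist y s) x).le_opNorm (y - x)
  rw [Real.norm_eq_abs, ← dist_eq_norm, dist_comm] at hop
  have := neg_le_abs (fderiv ℝ (fun y => infDist y s) x (y - x))
  nlinarith

end Eikonal

lemma isC11On_of_norm_gradient_eq_one {m : ℕ} {Ω : Set (EuclideanSpace ℝ (Fin m))}
    {φ : EuclideanSpace ℝ (Fin m) → ℝ} (hΩ : IsOpen Ω) (hd : ∀ x ∈ Ω, DifferentiableAt ℝ φ x)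
    (hg : ∀ x ∈ Ω, ‖gradient φ x‖ = 1) : IsC11On φ Ω :=
  have hlip := locallyLipschitzOn_gradient_of_norm_gradient_eq_one hΩ hd hg
  ⟨contDiffOn_one_of_continuousOn_gradient hΩ hd hlip.continuousOn, hlip⟩

lemma norm_gradient_signedBoundaryDist_eq_one {m : ℕ} {D : Set (EuclideanSpace ℝ (Fin m))}
    {x : EuclideanSpace ℝ (Fin m)} (hD : IsOpen D) (hne : (frontier D).Nonempty)
    (hx : x ∉ frontier D) (hd : DifferentiableAt ℝ (signedBoundaryDist D) x) :
    ‖gradient (signedBoundaryDist D) x‖ = 1 := by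
  by_cases hxD : x ∈ D
  · have heq : signedBoundaryDist D =ᶠ[𝓝 x] fun y => infDist y (frontier D) := by
      filter_upwards [hD.mem_nhds hxD] with y hy
      simp [signedBoundaryDist, hy]
    rw [heq.gradient_eq]
    exact norm_gradient_infDist_eq_one isClosed_frontier hne hx (heq.differentiableAt_iff.1 hd)
  -- As `D` is open, a point outside both `D` and its frontier is outside the closure, so the sign
  -- is constant nearby.
  · have hxc : x ∈ (closure D)ᶜ := fun h => hx ⟨h, by rwa [hD.interior_eq]⟩
    have heq : signedBoundaryDist D =ᶠ[𝓝 x] fun y => -infDist y (frontier D) := by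
      filter_upwards [isClosed_closure.isOpen_compl.mem_nhds hxc] with y hy
      have hyD : y ∉ D := fun h => hy (subset_closure h)
      simp [signedBoundaryDist, hyD]
    rw [heq.gradient_eq, gradient_fun_neg, norm_neg]
    refine norm_gradient_infDist_eq_one isClosed_frontier hne hx ?_
    simpa using (heq.differentiableAt_iff.1 hd).neg

theorem proposition2p4 (m : ℕ) :
    (∀ (Ω : Set (EuclideanSpace ℝ (Fin m))) (φ : EuclideanSpace ℝ (Fin m) → ℝ),
      IsOpen Ω →
      (∀ x ∈ Ω, DifferentiableAt ℝ φ x) →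
      (∀ x ∈ Ω, ‖gradient φ x‖ = 1) →
      IsC11On φ Ω) ∧
    (∀ D U : Set (EuclideanSpace ℝ (Fin m)),
      IsOpen D → D.Nonempty → D ≠ Set.univ →
      IsOpen U → frontier D ⊆ U →
      (∀ x ∈ U, DifferentiableAt ℝ (signedBoundaryDist D) x) →
      (∀ x ∈ U ∩ frontier D, ‖gradient (signedBoundaryDist D) x‖ = 1) →
      IsC11On (signedBoundaryDist D) U) := by

  refine ⟨fun Ω φ hΩ hd hg => isC11On_of_norm_gradient_eq_one hΩ hd hg,
    fun D U hD hne huniv hU hsub hd hg => isC11On_of_norm_gradient_eq_one hU hd fun x hx => ?_⟩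
  by_cases hxF : x ∈ frontier D
  · exact hg x ⟨hx, hxF⟩
  · exact norm_gradient_signedBoundaryDist_eq_one hD
      (nonempty_frontier_iff.2 ⟨hne, huniv⟩) hxF (hd x hx)
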